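/- There is a universal constant $C>0$ such that for all integers $n\ge 2$ and $k\ge 2$, every matrix $W\in\mathbb{R}^{n\times k}$ and every $\theta\in\mathbb{R}^k$, the (possibly unbounded) polytope with $k$ faces $\mathcal{K}=\{x\in\mathbb{R}^n : W^Tx\le\theta\}$ (coordinatewise inequality) satisfies $$\left|\Pr_{X}\left[X\in\mathcal{K}\right]-\Pr_{Y}\left[Y/\sqrt{n}\in\mathcal{K}\right]\right|\le\frac{C\,\log n\,\log k}{\sqrt{n}},$$ where $X$ is uniformly distributed on the unit sphere $S^{n-1}\subset\mathbb{R}^n$ and $Y$ is a standard Gaussian vector in $\mathbb{R}^n$ (mean $0$, identity covariance). -/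

import Mathlib

/-- The polytope `{x ∈ ℝⁿ : Wᵀ x ≤ θ}` (coordinatewise inequality) with `k` faces: the
intersection of the `k` halfspaces whose normals are the columns of `W`. -/
def polytope {n k : ℕ} (W : Matrix (Fin n) (Fin k) ℝ) (θ : Fin k → ℝ) :
    Set (EuclideanSpace ℝ (Fin n)) :=
  {x | W.transpose.mulVec x.ofLp ≤ θ}

/-- The uniform distribution on the unit sphere of `ℝⁿ`: the surface measure induced by
Lebesgue measure, normalized to total mass one. -/
noncomputable def sphereUniform (n : ℕ) :
    MeasureTheory.Measure (Metric.sphere (0 : EuclideanSpace ℝ (Fin n)) 1) :=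
  ((MeasureTheory.volume : MeasureTheory.Measure (EuclideanSpace ℝ (Fin n))).toSphere
      Set.univ)⁻¹ •
    (MeasureTheory.volume : MeasureTheory.Measure (EuclideanSpace ℝ (Fin n))).toSphere

/-! The direction `Y / ‖Y‖` of a Gaussian vector is uniform on the sphere
(`stdGaussian_normalize_mem`), so both probabilities become Gaussian measures. A Chernoff bound puts
`‖Y‖` within a factor `1 ± ε` of `√n`, where `ε` is of order `log n / √n`, outside an event of mass
`O(1 / √n)`. Off that event, replacing `‖Y‖` by `√n` moves each threshold `t j` by at most `ε * |t
j|`, so it remains to show that such a move costs `O(ε log k)`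
(`stdGaussian_real_dilate_halfspaces_le`).

A face at distance at least `4 √(log k)` from the origin costs `O(ε / k)` by Gaussian decay, and a
union bound handles all of these. For the nearer faces a union bound would lose a factor `k`.
Instead, space is cut into cells according to which affine function is largest. Each cell is closed
under translation along its own normal, so many disjoint translates of its boundary slab fit inside
it, and the slab has a small share of the mass of the cell (`stdGaussian_real_inter_slab_le`). The
cells are disjoint, so the shares add up without a factor `k`. -/

open MeasureTheory ProbabilityTheory Real
open scoped RealInnerProductSpace ENNReal

/-! ### Density, moment generating function and translation of the standard Gaussian. -/

section StdGaussian

variable {E : Type*} [NormedAddCommGroup E] [InnerProductSpace ℝ E]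

/-- The density of the standard Gaussian measure on a Euclidean space. -/
noncomputable def stdGaussianPDFReal (x : E) : ℝ :=
  (2 * π) ^ (-(Module.finrank ℝ E / 2 : ℝ)) * rexp (-‖x‖ ^ 2 / 2)

lemma stdGaussianPDFReal_nonneg (x : E) : 0 ≤ stdGaussianPDFReal x := by
  unfold stdGaussianPDFReal; positivity

variable [MeasurableSpace E] [BorelSpace E]

@[fun_prop]
lemma measurable_stdGaussianPDFReal : Measurable (stdGaussianPDFReal : E → ℝ) := by
  unfold stdGaussianPDFReal; fun_prop

variable [FiniteDimensional ℝ E]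

lemma integral_stdGaussianPDFReal_mul_exp {t : ℝ} (ht : t < 1 / 2) :
    ∫ x : E, stdGaussianPDFReal x * rexp (t * ‖x‖ ^ 2) =
      (1 - 2 * t) ^ (-(Module.finrank ℝ E / 2 : ℝ)) := by
  have hb : 0 < 1 / 2 - t := by linarith
  have h : ∀ x : E, stdGaussianPDFReal x * rexp (t * ‖x‖ ^ 2) =
      (2 * π) ^ (-(Module.finrank ℝ E / 2 : ℝ)) * rexp (-(1 / 2 - t) * ‖x‖ ^ 2) := by
    intro x
    rw [stdGaussianPDFReal, mul_assoc, ← Real.exp_add]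
    ring_nf
  simp_rw [h]
  rw [integral_const_mul, GaussianFourier.integral_rexp_neg_mul_sq_norm hb,
    rpow_neg (by positivity), rpow_neg (by linarith),
    show π / (1 / 2 - t) = (2 * π) / (1 - 2 * t) by
      have : (1 - 2 * t) ≠ 0 := by linarith
      field_simp,
    div_rpow (by positivity) (by linarith)]
  have : (0 : ℝ) < (2 * π) ^ (Module.finrank ℝ E / 2 : ℝ) := by positivity
  field_simp

lemma lintegral_stdGaussianPDFReal :
    ∫⁻ x : E, ENNReal.ofReal (stdGaussianPDFReal x) = 1 := by
  have h : ∫ x : E, stdGaussianPDFReal x = 1 := by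
    simpa using integral_stdGaussianPDFReal_mul_exp (E := E) (t := 0) (by norm_num)
  -- A Bochner integral with nonzero value can only come from an integrable function.
  have hi : Integrable (stdGaussianPDFReal : E → ℝ) :=
    not_imp_comm.1 integral_undef (by rw [h]; exact one_ne_zero)
  rw [← ofReal_integral_eq_lintegral_ofReal hi (ae_of_all _ stdGaussianPDFReal_nonneg), h]
  simp

/-- Both finite measures have the same characteristic function. The density form gives access to
polar coordinates and to translation estimates. -/
theorem stdGaussian_eq_withDensity :
    stdGaussian E = volume.withDensity fun x ↦ ENNReal.ofReal (stdGaussianPDFReal x) := by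
  have : IsFiniteMeasure
      ((volume : Measure E).withDensity fun x ↦ ENNReal.ofReal (stdGaussianPDFReal x)) :=
    ⟨by rw [withDensity_apply _ .univ, Measure.restrict_univ, lintegral_stdGaussianPDFReal]; simp⟩
  apply Measure.ext_of_charFun
  ext t
  rw [charFun_stdGaussian, charFun_apply,
    integral_withDensity_eq_integral_toReal_smul (by fun_prop) (by simp)]
  have h : ∀ x : E, (ENNReal.ofReal (stdGaussianPDFReal x)).toReal •
      Complex.exp (⟪x, t⟫ * Complex.I) =
      ((2 * π) ^ (-(Module.finrank ℝ E / 2 : ℝ)) : ℝ) *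
        Complex.exp (-(1 / 2 : ℂ) * ‖x‖ ^ 2 + Complex.I * ⟪t, x⟫) := by
    intro x
    rw [ENNReal.toReal_ofReal (stdGaussianPDFReal_nonneg x), stdGaussianPDFReal,
      Complex.real_smul, Complex.ofReal_mul, mul_assoc, Complex.ofReal_exp, ← Complex.exp_add,
      real_inner_comm]
    congr 2
    push_cast
    ring
  simp_rw [h]
  rw [integral_const_mul, GaussianFourier.integral_cexp_neg_mul_sq_norm_add (by norm_num)]
  have h2 : ((π : ℂ) / (1 / 2)) ^ (Module.finrank ℝ E / 2 : ℂ) =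
      (((2 * π) ^ (Module.finrank ℝ E / 2 : ℝ) : ℝ) : ℂ) := by
    rw [Complex.ofReal_cpow (by positivity)]
    push_cast
    congr 1
    ring
  rw [h2, ← mul_assoc, ← Complex.ofReal_mul, ← rpow_add (by positivity)]
  simp
  ring_nf

lemma mgf_norm_sq_stdGaussian {t : ℝ} (ht : t < 1 / 2) :
    mgf (fun x : E ↦ ‖x‖ ^ 2) (stdGaussian E) t =
      (1 - 2 * t) ^ (-(Module.finrank ℝ E / 2 : ℝ)) := by
  rw [mgf, stdGaussian_eq_withDensity,
    integral_withDensity_eq_integral_toReal_smul (by fun_prop) (by simp),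
    ← integral_stdGaussianPDFReal_mul_exp ht]
  simp [ENNReal.toReal_ofReal, stdGaussianPDFReal_nonneg]

lemma integrable_exp_mul_norm_sq_stdGaussian {t : ℝ} (ht : t < 1 / 2) :
    Integrable (fun x : E ↦ rexp (t * ‖x‖ ^ 2)) (stdGaussian E) := by
  refine not_imp_comm.1 integral_undef ?_
  have h := mgf_norm_sq_stdGaussian (E := E) ht
  rw [mgf] at h
  rw [h]
  exact (rpow_pos_of_pos (by linarith) _).ne'

/-- Translating a set by `v` decreases its Gaussian measure by a controlled factor. -/
lemma exp_neg_mul_stdGaussian_le_image_add {S : Set E} (hS : MeasurableSet S) (v : E) {c : ℝ}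
    (hc : ∀ x ∈ S, ⟪v, x⟫ + ‖v‖ ^ 2 / 2 ≤ c) :
    ENNReal.ofReal (rexp (-c)) * stdGaussian E S ≤ stdGaussian E ((fun x ↦ x + v) '' S) := by
  have hemb : MeasurableEmbedding (fun x : E ↦ x + v) := measurableEmbedding_addRight v
  rw [stdGaussian_eq_withDensity, withDensity_apply _ hS,
    withDensity_apply _ (hemb.measurableSet_image.2 hS),
    ← (measurePreserving_add_right volume v).setLIntegral_comp_emb hemb,
    ← lintegral_const_mul _ (by fun_prop)]
  refine setLIntegral_mono (by fun_prop) fun x hx ↦ ?_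
  rw [← ENNReal.ofReal_mul (by positivity)]
  refine ENNReal.ofReal_le_ofReal ?_
  rw [stdGaussianPDFReal, stdGaussianPDFReal, mul_left_comm, ← Real.exp_add]
  gcongr
  have h1 := hc x hx
  rw [norm_add_sq_real, real_inner_comm]
  linarith

end StdGaussian

/-! ### Polar coordinates. -/

section Polar

variable {E : Type*} [NormedAddCommGroup E] [InnerProductSpace ℝ E] [FiniteDimensional ℝ E]
  [MeasurableSpace E] [BorelSpace E] [Nontrivial E]

/-- The density is radial and the event depends only on direction, so the integral factors. The
radial factor does not depend on `K`; taking `K = univ` later identifies it. -/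
lemma stdGaussian_normalize_mem_eq_mul {K : Set E} (hK : MeasurableSet K) :
    stdGaussian E {y | ‖y‖⁻¹ • y ∈ K} =
      (volume : Measure E).toSphere {x | (x : E) ∈ K} *
        ∫⁻ r, ENNReal.ofReal ((2 * π) ^ (-(Module.finrank ℝ E / 2 : ℝ)) *
          rexp (-(r : ℝ) ^ 2 / 2)) ∂(Measure.volumeIoiPow (Module.finrank ℝ E - 1)) := by
  have hT : MeasurableSet {y : E | ‖y‖⁻¹ • y ∈ K} :=
    measurableSet_preimage (f := fun y : E ↦ ‖y‖⁻¹ • y) (by fun_prop) hK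
  have hS : MeasurableSet {x : Metric.sphere (0 : E) 1 | (x : E) ∈ K} :=
    measurable_subtype_coe hK
  have h0 : MeasurableSet ({0}ᶜ : Set E) := (measurableSet_singleton 0).compl
  rw [stdGaussian_eq_withDensity, withDensity_apply _ hT, ← lintegral_indicator hT]
  conv_lhs => rw [← restrict_compl_singleton (μ := (volume : Measure E)) 0,
    ← lintegral_subtype_comap h0]
  let F : Metric.sphere (0 : E) 1 × Set.Ioi (0 : ℝ) → ℝ≥0∞ := fun p ↦
    {x : Metric.sphere (0 : E) 1 | (x : E) ∈ K}.indicator 1 p.1 *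
      ENNReal.ofReal ((2 * π) ^ (-(Module.finrank ℝ E / 2 : ℝ)) * rexp (-(p.2 : ℝ) ^ 2 / 2))
  have hind : ∀ y : ({0}ᶜ : Set E),
      {y : E | ‖y‖⁻¹ • y ∈ K}.indicator (fun x ↦ ENNReal.ofReal (stdGaussianPDFReal x)) (y : E) =
      F (homeomorphUnitSphereProd E y) := by
    intro y
    by_cases hy : ‖(y : E)‖⁻¹ • (y : E) ∈ K
    · have hy' : (homeomorphUnitSphereProd E y).1 ∈
          {x : Metric.sphere (0 : E) 1 | (x : E) ∈ K} := by simpa using hy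
      rw [Set.indicator_of_mem (show (y : E) ∈ {y : E | ‖y‖⁻¹ • y ∈ K} from hy)]
      simp only [F]
      rw [Set.indicator_of_mem hy']
      simp [stdGaussianPDFReal]
    · have hy' : (homeomorphUnitSphereProd E y).1 ∉
          {x : Metric.sphere (0 : E) 1 | (x : E) ∈ K} := by simpa using hy
      rw [Set.indicator_of_notMem (show (y : E) ∉ {y : E | ‖y‖⁻¹ • y ∈ K} from hy)]
      simp only [F]
      rw [Set.indicator_of_notMem hy', zero_mul]
  rw [lintegral_congr hind,
    (volume : Measure E).measurePreserving_homeomorphUnitSphereProd.lintegral_comp_emb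
      (Homeomorph.measurableEmbedding _), ← lintegral_indicator_one hS]
  refine lintegral_prod_mul ?_ (g := fun r : Set.Ioi (0 : ℝ) ↦ ENNReal.ofReal
    ((2 * π) ^ (-(Module.finrank ℝ E / 2 : ℝ)) * rexp (-(r : ℝ) ^ 2 / 2))) ?_
  · exact (measurable_one.indicator hS).aemeasurable
  · fun_prop

/-- The direction of a standard Gaussian vector is uniformly distributed on the sphere. -/
theorem stdGaussian_normalize_mem {K : Set E} (hK : MeasurableSet K) :
    stdGaussian E {y | ‖y‖⁻¹ • y ∈ K} =
      ((volume : Measure E).toSphere Set.univ)⁻¹ *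
        (volume : Measure E).toSphere {x | (x : E) ∈ K} := by
  have h1 := stdGaussian_normalize_mem_eq_mul (E := E) MeasurableSet.univ
  simp only [Set.mem_univ, Set.ofPred_true, measure_univ] at h1
  rw [stdGaussian_normalize_mem_eq_mul hK, mul_comm,
    ENNReal.eq_inv_of_mul_eq_one_left ((mul_comm _ _).trans h1.symm)]

end Polar

/-! ### Concentration of the norm. -/

section Concentration

lemma one_sub_two_mul_rpow_neg_le {t d : ℝ} (ht : |t| ≤ 1 / 4) (hd : 0 ≤ d) :
    (1 - 2 * t) ^ (-(d / 2)) ≤ rexp (d * (t + 4 * t ^ 2)) := by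
  have hx : |2 * t| ≤ 1 / 2 := by rw [abs_mul, abs_two]; linarith
  have h := abs_log_sub_add_sum_range_le (show |2 * t| < 1 by linarith) 1
  have hpos : 0 < 1 - 2 * t := by have := le_abs_self (2 * t); linarith
  have h2 : |2 * t| ^ (1 + 1) / (1 - |2 * t|) ≤ 8 * t ^ 2 := by
    rw [one_add_one_eq_two, sq_abs, div_le_iff₀ (by linarith)]
    nlinarith [sq_nonneg t]
  have h3 : -log (1 - 2 * t) ≤ 2 * t + 8 * t ^ 2 := by
    have := (abs_le.1 (h.trans h2)).1
    simp at this
    linarith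
  rw [rpow_def_of_pos hpos]
  refine Real.exp_le_exp.2 ?_
  nlinarith

variable {E : Type*} [NormedAddCommGroup E] [InnerProductSpace ℝ E] [FiniteDimensional ℝ E]
  [MeasurableSpace E] [BorelSpace E]

/-- Concentration of the squared norm of a standard Gaussian vector around the dimension. -/
lemma stdGaussian_real_norm_sq_sub_ge_le {ε : ℝ} (h0 : 0 ≤ ε) (h1 : ε ≤ 1) :
    (stdGaussian E).real {y | ε * Module.finrank ℝ E ≤ |‖y‖ ^ 2 - Module.finrank ℝ E|} ≤
      2 * rexp (-(Module.finrank ℝ E * ε ^ 2 / 16)) := by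
  set d : ℝ := (Module.finrank ℝ E : ℝ) with hd
  have hd0 : 0 ≤ d := by positivity
  have hup : (stdGaussian E).real {y : E | d + ε * d ≤ ‖y‖ ^ 2} ≤ rexp (-(d * ε ^ 2 / 16)) := by
    -- The choice `t = ε / 8` minimises the Chernoff exponent `d * (4 * t ^ 2 - t * ε)`.
    refine (measure_ge_le_exp_mul_mgf (t := ε / 8) _ (by linarith)
      (integrable_exp_mul_norm_sq_stdGaussian (by linarith))).trans ?_
    rw [mgf_norm_sq_stdGaussian (by linarith), ← hd]
    grw [one_sub_two_mul_rpow_neg_le (by rw [abs_of_nonneg] <;> linarith) hd0]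
    rw [← Real.exp_add]
    apply (Real.exp_le_exp.2 _)
    ring_nf
    rfl
  have hlo : (stdGaussian E).real {y : E | ‖y‖ ^ 2 ≤ d - ε * d} ≤ rexp (-(d * ε ^ 2 / 16)) := by
    refine (measure_le_le_exp_mul_mgf (t := -(ε / 8)) _ (by linarith)
      (integrable_exp_mul_norm_sq_stdGaussian (by linarith))).trans ?_
    rw [mgf_norm_sq_stdGaussian (by linarith), ← hd]
    grw [one_sub_two_mul_rpow_neg_le (by rw [abs_neg, abs_of_nonneg] <;> linarith) hd0]
    rw [← Real.exp_add]
    apply (Real.exp_le_exp.2 _)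
    ring_nf
    rfl
  calc _ ≤ (stdGaussian E).real ({y : E | d + ε * d ≤ ‖y‖ ^ 2} ∪ {y : E | ‖y‖ ^ 2 ≤ d - ε * d}) := by
        refine measureReal_mono fun y hy ↦ ?_
        rcases le_abs.1 (show ε * d ≤ |‖y‖ ^ 2 - d| from hy) with h | h
        · left; simp only [Set.mem_ofPred_eq]; linarith
        · right; simp only [Set.mem_ofPred_eq]; linarith
    _ ≤ _ := (measureReal_union_le _ _).trans (by linarith)

end Concentration

/-! ### Anti-concentration at the boundary of a polytope. -/

section AntiConcentration

variable {E : Type*} [NormedAddCommGroup E] [InnerProductSpace ℝ E] [FiniteDimensional ℝ E]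
  [MeasurableSpace E] [BorelSpace E]

lemma measurableSet_slab (u : E) (a b : ℝ) : MeasurableSet {x : E | a < ⟪u, x⟫ ∧ ⟪u, x⟫ ≤ b} :=
  measurableSet_preimage (f := fun x : E ↦ ⟪u, x⟫) (by fun_prop) measurableSet_Ioc

/-- A set which is closed under translation in the direction `u` puts only a proportional amount of
its Gaussian mass in a thin slab orthogonal to `u`. -/
lemma stdGaussian_real_inter_slab_le {A : Set E} (hA : MeasurableSet A) {u : E} (hu : ‖u‖ = 1)
    (hup : ∀ x ∈ A, ∀ s : ℝ, 0 ≤ s → x + s • u ∈ A) {a δ T : ℝ} (ha : |a| ≤ T) (hδ : 0 < δ) :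
    (stdGaussian E).real (A ∩ {x | a < ⟪u, x⟫ ∧ ⟪u, x⟫ ≤ a + δ}) ≤
      16 * (δ * (1 + T)) * (stdGaussian E).real A := by
  have hT : 0 ≤ T := (abs_nonneg a).trans ha
  set γ := stdGaussian E
  set S := A ∩ {x | a < ⟪u, x⟫ ∧ ⟪u, x⟫ ≤ a + δ} with hSdef
  have hS : MeasurableSet S := hA.inter (measurableSet_slab u a (a + δ))
  set q := δ * (1 + T) with hq
  have hq0 : 0 < q := by positivity
  have hle : γ.real S ≤ γ.real A := measureReal_mono Set.inter_subset_left
  -- For `q ≥ 1 / 16` the bound is trivial; otherwise about `1 / q` translates of the slab by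
  -- multiples of `δ` are packed into `A`.
  rcases le_total (1 / 16) q with hbig | hsmall
  · nlinarith [measureReal_nonneg (μ := γ) (s := A)]
  set N := ⌊1 / q⌋₊
  have hN1 : (N : ℝ) * q ≤ 1 := by
    have := Nat.floor_le (show 0 ≤ 1 / q by positivity)
    rwa [le_div_iff₀ hq0] at this
  have hN2 : 1 / 2 ≤ (N : ℝ) * q := by
    have := Nat.lt_floor_add_one (1 / q)
    rw [div_lt_iff₀ hq0] at this
    linarith
  let V : ℕ → Set E := fun m ↦ (fun x ↦ x + ((m : ℝ) * δ) • u) '' S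
  have hVmeas : ∀ m, MeasurableSet (V m) := fun m ↦
    (measurableEmbedding_addRight (((m : ℝ) * δ) • u)).measurableSet_image.2 hS
  have hinner : ∀ (x : E) (s : ℝ), ⟪u, x + s • u⟫ = ⟪u, x⟫ + s := by
    intro x s
    rw [inner_add_right, real_inner_smul_right, real_inner_self_eq_norm_sq, hu]
    ring
  have hVA : ∀ m, V m ⊆ A := by
    rintro m _ ⟨x, hx, rfl⟩
    exact hup x hx.1 _ (by positivity)
  have hVlt : ∀ m l, m < l → Disjoint (V m) (V l) := by
    intro m l hml
    rw [Set.disjoint_left]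
    rintro _ ⟨x, hx, rfl⟩ ⟨y, hy, hxy⟩
    have h := congrArg (fun z ↦ ⟪u, z⟫) hxy
    simp only [hinner] at h
    have h1 := hx.2.2
    have h2 := hy.2.1
    have h3 : (m : ℝ) + 1 ≤ l := by exact_mod_cast hml
    nlinarith
  have hVdisj : Pairwise (Function.onFun Disjoint V) := by
    intro m l hml
    rcases lt_or_gt_of_ne hml with h | h
    · exact hVlt m l h
    · exact (hVlt l m h).symm
  have hlow : ∀ m ∈ Finset.range N, rexp (-2) * γ.real S ≤ γ.real (V m) := by
    intro m hm
    have hmN : (m : ℝ) ≤ N := by exact_mod_cast (Finset.mem_range.1 hm).le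
    have hs : (m : ℝ) * δ * (1 + T) ≤ 1 := by
      calc _ = (m : ℝ) * q := by rw [hq]; ring
        _ ≤ N * q := by gcongr
        _ ≤ 1 := hN1
    have hs0 : 0 ≤ (m : ℝ) * δ := by positivity
    -- With `s = m * δ`, the exponent is at most `s * (T + δ) + s ^ 2 / 2`, which is below `2`
    -- because `s * (1 + T) ≤ 1` and `δ, s ≤ 1`.
    have h := exp_neg_mul_stdGaussian_le_image_add hS (((m : ℝ) * δ) • u) (c := 2) ?_
    · have := ENNReal.toReal_mono (measure_ne_top _ _) h
      rwa [ENNReal.toReal_mul, ENNReal.toReal_ofReal (by positivity)] at this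
    · intro x hx
      rw [real_inner_smul_left, norm_smul, hu, mul_one, Real.norm_eq_abs, sq_abs]
      have h1 : ⟪u, x⟫ ≤ T + δ := hx.2.2.trans (by linarith [le_abs_self a])
      have h2 : δ ≤ 1 := by nlinarith
      have h3 : (m : ℝ) * δ ≤ 1 := by nlinarith
      nlinarith
  have hsum : (N : ℝ) * (rexp (-2) * γ.real S) ≤ γ.real A := by
    calc (N : ℝ) * (rexp (-2) * γ.real S) = ∑ _m ∈ Finset.range N, rexp (-2) * γ.real S := by simp
      _ ≤ ∑ m ∈ Finset.range N, γ.real (V m) := Finset.sum_le_sum hlow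
      _ = γ.real (⋃ m ∈ Finset.range N, V m) :=
        (measureReal_biUnion_finset (fun m _ l _ h ↦ hVdisj h) fun m _ ↦ hVmeas m).symm
      _ ≤ γ.real A := measureReal_mono (Set.iUnion₂_subset fun m _ ↦ hVA m)
  have hexp : 1 / 8 ≤ rexp (-2) := by
    rw [Real.exp_neg, ← one_div]
    have h1 : rexp 2 = rexp 1 * rexp 1 := by rw [← Real.exp_add]; norm_num
    have h2 := Real.exp_one_lt_d9
    have h3 := Real.exp_pos 1
    refine one_div_le_one_div_of_le (Real.exp_pos 2) ?_
    nlinarith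
  have hS0 : 0 ≤ γ.real S := measureReal_nonneg
  calc γ.real S = 16 * (1 / 2 * (1 / 8 * γ.real S)) := by ring
    _ ≤ 16 * (N * q * (rexp (-2) * γ.real S)) := by gcongr
    _ = 16 * q * (N * (rexp (-2) * γ.real S)) := by ring
    _ ≤ 16 * q * γ.real A := by gcongr

/-- Anti-concentration of the maximum of finitely many affine functions of unit slope under the
standard Gaussian measure. -/
lemma stdGaussian_real_shift_halfspaces_le {ι : Type*} [LinearOrder ι] (M : Finset ι)
    {u : ι → E} (hu : ∀ j ∈ M, ‖u j‖ = 1) {t : ι → ℝ} {T δ : ℝ} (hT : 0 ≤ T)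
    (ht : ∀ j ∈ M, |t j| ≤ T) (hδ : 0 < δ) :
    (stdGaussian E).real {x | (∀ j ∈ M, ⟪u j, x⟫ ≤ t j + δ) ∧ ∃ j ∈ M, t j < ⟪u j, x⟫} ≤
      16 * (δ * (1 + T)) := by
  set γ := stdGaussian E
  -- Cell where `j` is the least maximiser in `M`; the strict clause breaks ties and makes the cells
  -- disjoint.
  let A : ι → Set E := fun j ↦ {x | ∀ i ∈ M, ⟪u i, x⟫ - t i ≤ ⟪u j, x⟫ - t j ∧
    (i < j → ⟪u i, x⟫ - t i < ⟪u j, x⟫ - t j)}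
  have hAmeas : ∀ j, MeasurableSet (A j) := by
    intro j
    have : A j = ⋂ i ∈ M, ({x | ⟪u i, x⟫ - t i ≤ ⟪u j, x⟫ - t j} ∩
        {x | i < j → ⟪u i, x⟫ - t i < ⟪u j, x⟫ - t j}) := by
      ext x
      simp [A]
    rw [this]
    refine Finset.measurableSet_biInter _ fun i _ ↦
      (measurableSet_le (by fun_prop) (by fun_prop)).inter ?_
    by_cases h : i < j
    · simpa [h] using measurableSet_lt (f := fun x : E ↦ ⟪u i, x⟫ - t i)
        (g := fun x : E ↦ ⟪u j, x⟫ - t j) (by fun_prop) (by fun_prop)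
    · simp [h]
  have hAup : ∀ j ∈ M, ∀ x ∈ A j, ∀ s : ℝ, 0 ≤ s → x + s • u j ∈ A j := by
    intro j hj x hx s hs i hi
    have h1 : ⟪u j, u j⟫ = 1 := by rw [real_inner_self_eq_norm_sq, hu j hj]; norm_num
    -- Among unit normals, moving along `u j` raises the `j`-th function at least as fast as any
    -- other, so `j` stays maximal.
    have h2 : ⟪u i, u j⟫ ≤ 1 := by
      simpa [hu i hi, hu j hj] using real_inner_le_norm (u i) (u j)
    simp only [inner_add_right, real_inner_smul_right, h1]
    have h3 := mul_le_mul_of_nonneg_left h2 hs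
    exact ⟨by linarith [(hx i hi).1], fun hij ↦ by linarith [(hx i hi).2 hij]⟩
  have hAlt : ∀ i ∈ M, ∀ j ∈ M, i < j → Disjoint (A i) (A j) := by
    intro i hi j hj hij
    rw [Set.disjoint_left]
    intro x hx hx'
    exact absurd ((hx' i hi).2 hij) (not_lt.2 (hx j hj).1)
  have hAdisj : (M : Set ι).PairwiseDisjoint A := by
    intro i hi j hj hij
    rcases lt_or_gt_of_ne hij with h | h
    · exact hAlt i hi j hj h
    · exact (hAlt j hj i hi h).symm
  have hcover : {x | (∀ j ∈ M, ⟪u j, x⟫ ≤ t j + δ) ∧ ∃ j ∈ M, t j < ⟪u j, x⟫} ⊆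
      ⋃ j ∈ M, A j ∩ {x | t j < ⟪u j, x⟫ ∧ ⟪u j, x⟫ ≤ t j + δ} := by
    rintro x ⟨hx, l, hl, hlx⟩
    obtain ⟨m, hm, hmax⟩ := M.exists_max_image (fun i ↦ ⟪u i, x⟫ - t i) ⟨l, hl⟩
    obtain ⟨j, hj, hmin⟩ := (M.filter fun j ↦ ∀ i ∈ M, ⟪u i, x⟫ - t i ≤ ⟪u j, x⟫ - t j).exists_min_image
      id ⟨m, Finset.mem_filter.2 ⟨hm, hmax⟩⟩
    obtain ⟨hjM, hjmax⟩ := Finset.mem_filter.1 hj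
    refine Set.mem_biUnion hjM ⟨fun i hi ↦ ⟨hjmax i hi, fun hij ↦ ?_⟩, ?_, hx j hjM⟩
    · by_contra hcon
      have : j ≤ i := hmin i (Finset.mem_filter.2
        ⟨hi, fun l hl ↦ (hjmax l hl).trans (not_lt.1 hcon)⟩)
      exact absurd hij (not_lt.2 this)
    · linarith [hjmax l hl]
  calc _ ≤ γ.real (⋃ j ∈ M, A j ∩ {x | t j < ⟪u j, x⟫ ∧ ⟪u j, x⟫ ≤ t j + δ}) :=
        measureReal_mono hcover (measure_ne_top _ _)
    _ ≤ ∑ j ∈ M, γ.real (A j ∩ {x | t j < ⟪u j, x⟫ ∧ ⟪u j, x⟫ ≤ t j + δ}) :=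
        measureReal_biUnion_finset_le _ _
    _ ≤ ∑ j ∈ M, 16 * (δ * (1 + T)) * γ.real (A j) := Finset.sum_le_sum fun j hj ↦
        stdGaussian_real_inter_slab_le (hAmeas j) (hu j hj) (hAup j hj) (ht j hj) hδ
    _ = 16 * (δ * (1 + T)) * γ.real (⋃ j ∈ M, A j) := by
        rw [measureReal_biUnion_finset hAdisj fun j _ ↦ hAmeas j, Finset.mul_sum]
    _ ≤ 16 * (δ * (1 + T)) * 1 := by gcongr; exact measureReal_le_one
    _ = _ := mul_one _

lemma map_inner_stdGaussian {u : E} (hu : ‖u‖ = 1) :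
    (stdGaussian E).map (fun x ↦ ⟪u, x⟫) = gaussianReal 0 1 := by
  have h := IsGaussian.map_eq_gaussianReal (μ := stdGaussian E) (innerSL ℝ u)
  rw [integral_strongDual_stdGaussian, variance_dual_stdGaussian, innerSL_apply_norm, hu] at h
  simpa using h

/-- The Gaussian measure of a relatively thin slab far from the origin. -/
lemma stdGaussian_real_far_slab_le {u : E} (hu : ‖u‖ = 1) {a ε L : ℝ} (hε : 0 ≤ ε)
    (hε' : ε ≤ 1 / 2) (ha : 16 * L ≤ a ^ 2) :
    (stdGaussian E).real {x | a < ⟪u, x⟫ ∧ ⟪u, x⟫ ≤ a + ε * |a|} ≤ 4 * ε * rexp (-L) := by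
  have hpdf : ∀ y ∈ Set.Ioc a (a + ε * |a|), gaussianPDFReal 0 1 y ≤ rexp (-a ^ 2 / 8) := by
    intro y hy
    -- For negative `a` the slab extends towards the origin; `ε ≤ 1 / 2` stops it halfway.
    have h1 : |a| / 2 ≤ |y| := by
      rcases le_total 0 a with h | h
      · rw [abs_of_nonneg h, abs_of_nonneg (h.trans hy.1.le)]; linarith [hy.1]
      · have := hy.2
        rw [abs_of_nonpos h] at this ⊢
        have hy0 : y ≤ 0 := by nlinarith
        rw [abs_of_nonpos hy0]; nlinarith
    have h2 : a ^ 2 / 4 ≤ y ^ 2 := by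
      rw [← sq_abs a, ← sq_abs y]; nlinarith [abs_nonneg a]
    rw [gaussianPDFReal]
    have h3 : (√(2 * π * (1 : NNReal)))⁻¹ ≤ 1 := by
      apply inv_le_one_of_one_le₀
      rw [Real.one_le_sqrt]
      push_cast
      linarith [Real.pi_gt_three]
    calc _ ≤ 1 * rexp (-(y - 0) ^ 2 / (2 * (1 : NNReal))) := by gcongr
      _ ≤ _ := by
        rw [one_mul]
        refine Real.exp_le_exp.2 ?_
        push_cast
        linarith [sub_zero y ▸ h2, show (y - 0) ^ 2 = y ^ 2 by ring]
  have hmap : (stdGaussian E).real {x | a < ⟪u, x⟫ ∧ ⟪u, x⟫ ≤ a + ε * |a|} =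
      (gaussianReal 0 1).real (Set.Ioc a (a + ε * |a|)) := by
    rw [← map_inner_stdGaussian hu, map_measureReal_apply (by fun_prop) measurableSet_Ioc]
    rfl
  have hle : (gaussianReal 0 1).real (Set.Ioc a (a + ε * |a|)) ≤ ε * |a| * rexp (-a ^ 2 / 8) := by
    refine ENNReal.toReal_le_of_le_ofReal (by positivity) ?_
    rw [gaussianReal_apply _ one_ne_zero]
    calc ∫⁻ y in Set.Ioc a (a + ε * |a|), gaussianPDF 0 1 y
        ≤ ∫⁻ _ in Set.Ioc a (a + ε * |a|), ENNReal.ofReal (rexp (-a ^ 2 / 8)) :=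
          setLIntegral_mono measurable_const fun y hy ↦ ENNReal.ofReal_le_ofReal (hpdf y hy)
      _ = ENNReal.ofReal (ε * |a| * rexp (-a ^ 2 / 8)) := by
          rw [setLIntegral_const, Real.volume_Ioc, ← ENNReal.ofReal_mul (by positivity)]
          congr 1
          ring
  rw [hmap]
  refine hle.trans ?_
  -- Half of the Gaussian decay absorbs the width factor `|a|`; the other half gives `rexp (-L)`.
  have h4 : |a| ≤ 4 * rexp (a ^ 2 / 16) := by
    have := Real.add_one_le_exp (a ^ 2 / 16)
    nlinarith [sq_nonneg (|a| - 2), sq_abs a]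
  calc ε * |a| * rexp (-a ^ 2 / 8) ≤ ε * (4 * rexp (a ^ 2 / 16)) * rexp (-a ^ 2 / 8) := by gcongr
    _ = 4 * ε * rexp (-(a ^ 2 / 16)) := by
        rw [show -(a ^ 2 / 16) = a ^ 2 / 16 + -a ^ 2 / 8 by ring, Real.exp_add]; ring
    _ ≤ 4 * ε * rexp (-L) := by gcongr; linarith

/-- Dilating a polytope with `k` faces by a factor `1 ± ε` changes its Gaussian measure by
`O(ε log k)`. -/
theorem stdGaussian_real_dilate_halfspaces_le {k : ℕ} (hk : 2 ≤ k) (w : Fin k → E)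
    (t : Fin k → ℝ) {ε : ℝ} (hε : 0 < ε) (hε' : ε ≤ 1 / 2) :
    (stdGaussian E).real {x | ∀ j, ⟪w j, x⟫ ≤ t j + ε * |t j|} ≤
      (stdGaussian E).real {x | ∀ j, ⟪w j, x⟫ ≤ t j} + 360 * ε * log k := by
  classical
  set γ := stdGaussian E
  have hk0 : (0 : ℝ) < k := by positivity
  set L := log k with hL
  have hL2 : 1 / 2 ≤ L := by
    have h1 : log 2 ≤ L := log_le_log (by norm_num) (by exact_mod_cast hk)
    linarith [Real.log_two_gt_d9]
  -- Makes `T ^ 2 = 16 * L`, so each far slab has mass at most `4 * ε / k`.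
  set T := 4 * √L with hT
  have hT0 : 0 < T := by have : 0 < √L := Real.sqrt_pos.2 (by linarith)
                         positivity
  have hTsq : T ^ 2 = 16 * L := by rw [hT, mul_pow, Real.sq_sqrt (by linarith)]; norm_num
  let B : Finset (Fin k) := Finset.univ.filter fun j ↦ w j = 0 ∨ T * ‖w j‖ ≤ |t j|
  let M : Finset (Fin k) := Finset.univ.filter fun j ↦ ¬ (w j = 0 ∨ T * ‖w j‖ ≤ |t j|)
  have hM : ∀ j ∈ M, 0 < ‖w j‖ ∧ |t j| < T * ‖w j‖ := by
    intro j hj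
    have := (Finset.mem_filter.1 hj).2
    push Not at this
    exact ⟨norm_pos_iff.2 this.1, this.2⟩
  let slab : Fin k → Set E := fun j ↦ {x | t j < ⟪w j, x⟫ ∧ ⟪w j, x⟫ ≤ t j + ε * |t j|}
  let u : Fin k → E := fun j ↦ ‖w j‖⁻¹ • w j
  let a : Fin k → ℝ := fun j ↦ ‖w j‖⁻¹ * t j
  have hunit : ∀ j, 0 < ‖w j‖ → ‖u j‖ = 1 := fun j hj ↦ by
    simp only [u, norm_smul, norm_inv, norm_norm]
    exact inv_mul_cancel₀ hj.ne'
  have hlt : ∀ j, 0 < ‖w j‖ → ∀ x, t j < ⟪w j, x⟫ → a j < ⟪u j, x⟫ := fun j hj x h ↦ by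
    simp only [u, a, real_inner_smul_left]
    gcongr
  have habs : ∀ j, |a j| = ‖w j‖⁻¹ * |t j| := fun j ↦ by
    simp only [a, abs_mul, abs_inv, abs_norm]
  have hle : ∀ j, ∀ x, ⟪w j, x⟫ ≤ t j + ε * |t j| → ⟪u j, x⟫ ≤ a j + ε * |a j| :=
    fun j x h ↦ by
    calc ⟪u j, x⟫ = ‖w j‖⁻¹ * ⟪w j, x⟫ := real_inner_smul_left _ _ _
      _ ≤ ‖w j‖⁻¹ * (t j + ε * |t j|) := by gcongr
      _ = a j + ε * |a j| := by rw [habs]; ring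
  have hslab : ∀ j ∈ B, γ.real (slab j) ≤ 4 * ε / k := by
    intro j hj
    by_cases hw : w j = 0
    · have : slab j = ∅ := by
        ext x
        simp only [slab, hw, inner_zero_left, Set.mem_ofPred_eq, Set.mem_empty_iff_false, iff_false,
          not_and, not_le]
        intro h
        rw [abs_of_neg h]
        nlinarith
      rw [this, measureReal_empty]
      positivity
    · have hw0 : 0 < ‖w j‖ := norm_pos_iff.2 hw
      have hTt : T * ‖w j‖ ≤ |t j| := ((Finset.mem_filter.1 hj).2).resolve_left hw
      have hTa : T ≤ |a j| := by
        rw [habs, inv_mul_eq_div, le_div_iff₀ hw0]; exact hTt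
      calc γ.real (slab j) ≤ γ.real {x | a j < ⟪u j, x⟫ ∧ ⟪u j, x⟫ ≤ a j + ε * |a j|} :=
            measureReal_mono fun x hx ↦ ⟨hlt j hw0 x hx.1, hle j x hx.2⟩
        _ ≤ 4 * ε * rexp (-L) := stdGaussian_real_far_slab_le (hunit j hw0) hε.le hε' (by
            rw [← hTsq, ← sq_abs (a j)]; gcongr)
        _ = 4 * ε / k := by rw [hL, Real.exp_neg, Real.exp_log hk0]; rfl
  -- On `M` the relative shift `ε * |a j|` is at most the uniform shift `ε * T`.
  have hmod : γ.real {x | (∀ j ∈ M, ⟪u j, x⟫ ≤ a j + ε * T) ∧ ∃ j ∈ M, a j < ⟪u j, x⟫} ≤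
      16 * (ε * T * (1 + T)) := by
    refine stdGaussian_real_shift_halfspaces_le M (fun j hj ↦ hunit j (hM j hj).1) hT0.le
      (fun j hj ↦ ?_) (by positivity)
    rw [habs, inv_mul_eq_div, div_le_iff₀ (hM j hj).1]
    exact (hM j hj).2.le
  have hcover : {x | ∀ j, ⟪w j, x⟫ ≤ t j + ε * |t j|} ⊆
      {x | ∀ j, ⟪w j, x⟫ ≤ t j} ∪ ((⋃ j ∈ B, slab j) ∪
        {x | (∀ j ∈ M, ⟪u j, x⟫ ≤ a j + ε * T) ∧ ∃ j ∈ M, a j < ⟪u j, x⟫}) := by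
    intro x hx
    by_cases hxK : ∀ j, ⟪w j, x⟫ ≤ t j
    · exact Or.inl hxK
    push Not at hxK
    obtain ⟨j, hj⟩ := hxK
    by_cases hjB : w j = 0 ∨ T * ‖w j‖ ≤ |t j|
    · exact Or.inr (Or.inl (Set.mem_biUnion
        (Finset.mem_coe.2 (Finset.mem_filter.2 ⟨Finset.mem_univ j, hjB⟩)) ⟨hj, hx j⟩))
    · have hjM : j ∈ M := Finset.mem_filter.2 ⟨Finset.mem_univ j, hjB⟩
      refine Or.inr (Or.inr ⟨fun i hi ↦ (hle i x (hx i)).trans ?_, j, hjM, hlt j (hM j hjM).1 x hj⟩)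
      have : |a i| ≤ T := by
        rw [habs, inv_mul_eq_div, div_le_iff₀ (hM i hi).1]
        exact (hM i hi).2.le
      gcongr
  have hB : ∑ j ∈ B, γ.real (slab j) ≤ 4 * ε := by
    calc ∑ j ∈ B, γ.real (slab j) ≤ ∑ _j ∈ B, 4 * ε / k := Finset.sum_le_sum hslab
      _ = B.card * (4 * ε / k) := by simp
      _ ≤ k * (4 * ε / k) := by
        gcongr
        simpa using B.card_le_univ
      _ = 4 * ε := by field_simp
  have hsqrt : √L ≤ 3 / 2 * L := by
    nlinarith [Real.sq_sqrt (show 0 ≤ L by linarith), sq_nonneg (√L - 1)]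
  have hfin : 4 * ε + 16 * (ε * T * (1 + T)) ≤ 360 * ε * L := by
    have h1 : T * (1 + T) = 4 * √L + 16 * L := by rw [← hTsq, hT]; ring
    have h2 : 4 + 16 * (T * (1 + T)) ≤ 360 * L := by rw [h1]; linarith
    calc _ = ε * (4 + 16 * (T * (1 + T))) := by ring
      _ ≤ ε * (360 * L) := by gcongr
      _ = _ := by ring
  calc _ ≤ γ.real {x | ∀ j, ⟪w j, x⟫ ≤ t j} + (γ.real (⋃ j ∈ B, slab j) +
        γ.real {x | (∀ j ∈ M, ⟪u j, x⟫ ≤ a j + ε * T) ∧ ∃ j ∈ M, a j < ⟪u j, x⟫}) :=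
        (measureReal_mono hcover (measure_ne_top _ _)).trans ((measureReal_union_le _ _).trans (by
          gcongr; exact measureReal_union_le _ _))
    _ ≤ _ := by
      have := measureReal_biUnion_finset_le (μ := γ) B slab
      linarith

end AntiConcentration

/-! ### From directions to rescaled Gaussian vectors. -/

section SphereComparison

lemma abs_sub_sqrt_lt {r d ε : ℝ} (hr : 0 ≤ r) (hd : 0 < d)
    (h : |r ^ 2 - d| < ε * d) : |r - √d| < ε * √d := by
  have hs : 0 < √d := Real.sqrt_pos.2 hd
  have hfac : |r ^ 2 - d| = |r - √d| * (r + √d) := by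
    rw [← abs_of_nonneg (show 0 ≤ r + √d by positivity), ← abs_mul]
    congr 1
    linear_combination Real.sq_sqrt hd.le
  have h1 : |r - √d| * √d ≤ |r ^ 2 - d| := by
    rw [hfac]; gcongr; linarith [hr]
  have h2 : |r - √d| * √d < ε * √d * √d := by
    rw [mul_assoc, Real.mul_self_sqrt hd.le]; linarith
  exact lt_of_mul_lt_mul_right h2 hs.le

variable {E : Type*} [NormedAddCommGroup E] [InnerProductSpace ℝ E] [FiniteDimensional ℝ E]
  [MeasurableSpace E] [BorelSpace E]

/-- The Gaussian mass of the cone of directions lying in a polytope compared with the Gaussian mass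
of the polytope rescaled by the square root of the dimension. -/
theorem abs_stdGaussian_normalize_sub_scaled_le [Nontrivial E] {k : ℕ} (hk : 2 ≤ k)
    (w : Fin k → E) (θ : Fin k → ℝ) {ε : ℝ} (hε : 0 < ε) (hε' : ε ≤ 1 / 4) :
    |(stdGaussian E).real {y | ∀ j, ⟪w j, ‖y‖⁻¹ • y⟫ ≤ θ j} -
      (stdGaussian E).real {y | ∀ j, ⟪w j, y⟫ ≤ √(Module.finrank ℝ E) * θ j}| ≤
      720 * ε * log k + 2 * rexp (-(Module.finrank ℝ E * ε ^ 2 / 16)) := by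
  have hd : (0 : ℝ) < Module.finrank ℝ E := by exact_mod_cast Module.finrank_pos
  have htail := stdGaussian_real_norm_sq_sub_ge_le (E := E) hε.le (by linarith)
  set d : ℝ := (Module.finrank ℝ E : ℝ)
  set γ := stdGaussian E
  set tail := {y : E | ε * d ≤ |‖y‖ ^ 2 - d|}
  have hs : 0 < √d := Real.sqrt_pos.2 hd
  have hlogk : 0 ≤ log k := log_natCast_nonneg k
  have hnear : ∀ y ∉ tail, 0 < ‖y‖ ∧ ∀ j, |‖y‖ * θ j - √d * θ j| ≤ ε * |√d * θ j| := by
    intro y hy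
    have h := abs_sub_sqrt_lt (norm_nonneg y) hd (not_le.1 hy)
    refine ⟨?_, fun j ↦ ?_⟩
    · have := (abs_lt.1 h).1
      nlinarith
    · rw [← sub_mul, abs_mul, abs_mul, abs_of_pos hs, ← mul_assoc]
      gcongr
  have hcone : ∀ y : E, 0 < ‖y‖ → ∀ j, ⟪w j, ‖y‖⁻¹ • y⟫ ≤ θ j ↔ ⟪w j, y⟫ ≤ ‖y‖ * θ j := by
    intro y hy j
    rw [real_inner_smul_right, inv_mul_le_iff₀ hy]
  have hup : γ.real {y | ∀ j, ⟪w j, ‖y‖⁻¹ • y⟫ ≤ θ j} ≤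
      γ.real {y | ∀ j, ⟪w j, y⟫ ≤ √d * θ j + ε * |√d * θ j|} + γ.real tail := by
    refine (measureReal_mono ?_ (measure_ne_top _ _)).trans (measureReal_union_le _ _)
    intro y hy
    by_cases hyt : y ∈ tail
    · exact Or.inr hyt
    refine Or.inl fun j ↦ ?_
    have h1 := (hcone y (hnear y hyt).1 j).1 (hy j)
    linarith [(abs_le.1 ((hnear y hyt).2 j)).2]
  have hlo : γ.real {y | ∀ j, ⟪w j, y⟫ ≤ √d * θ j - ε * |√d * θ j|} ≤
      γ.real {y | ∀ j, ⟪w j, ‖y‖⁻¹ • y⟫ ≤ θ j} + γ.real tail := by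
    refine (measureReal_mono ?_ (measure_ne_top _ _)).trans (measureReal_union_le _ _)
    intro y hy
    by_cases hyt : y ∈ tail
    · exact Or.inr hyt
    refine Or.inl fun j ↦ (hcone y (hnear y hyt).1 j).2 ?_
    linarith [(abs_le.1 ((hnear y hyt).2 j)).1, hy j]
  have hdil := stdGaussian_real_dilate_halfspaces_le hk w (fun j ↦ √d * θ j) hε (by linarith)
  -- The lower bound starts from the shrunken polytope; enlarging it by `2 * ε` covers the original
  -- one, since `2 * ε * (1 - ε) ≥ ε`.
  have hdil' := stdGaussian_real_dilate_halfspaces_le hk w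
    (fun j ↦ √d * θ j - ε * |√d * θ j|) (ε := 2 * ε) (by linarith) (by linarith)
  have hmono : γ.real {y | ∀ j, ⟪w j, y⟫ ≤ √d * θ j} ≤ γ.real {y | ∀ j, ⟪w j, y⟫ ≤
      √d * θ j - ε * |√d * θ j| + 2 * ε * |(√d * θ j - ε * |√d * θ j|)|} := by
    refine measureReal_mono (fun y hy j ↦ (hy j).trans ?_) (measure_ne_top _ _)
    have h1 : (1 - ε) * |√d * θ j| ≤ |(√d * θ j - ε * |√d * θ j|)| := by
      have := abs_sub_abs_le_abs_sub (√d * θ j) (ε * |√d * θ j|)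
      rw [abs_mul ε, abs_abs, abs_of_pos hε] at this
      linarith
    have h2 : 1 / 2 * |√d * θ j| ≤ (1 - ε) * |√d * θ j| := by gcongr; linarith
    nlinarith
  have h0 : 0 ≤ ε * log k := by positivity
  rw [abs_le]
  constructor <;> linarith

end SphereComparison

/-! ### The polytope in coordinates and the final estimate. -/

lemma mem_polytope_iff_inner {n k : ℕ} (W : Matrix (Fin n) (Fin k) ℝ) (θ : Fin k → ℝ)
    (x : EuclideanSpace ℝ (Fin n)) :
    x ∈ polytope W θ ↔ ∀ j, ⟪WithLp.toLp 2 (W.transpose j), x⟫ ≤ θ j := by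
  simp only [polytope, Set.mem_ofPred_eq, Pi.le_def, Matrix.mulVec, dotProduct, PiLp.inner_apply,
    RCLike.inner_apply, conj_trivial]
  simp only [mul_comm]

lemma measurableSet_polytope {n k : ℕ} (W : Matrix (Fin n) (Fin k) ℝ) (θ : Fin k → ℝ) :
    MeasurableSet (polytope W θ) := by
  have : polytope W θ = ⋂ j, {x : EuclideanSpace ℝ (Fin n) |
      ⟪WithLp.toLp 2 (W.transpose j), x⟫ ≤ θ j} := by
    ext x
    simp [mem_polytope_iff_inner]
  rw [this]
  exact MeasurableSet.iInter fun j ↦ measurableSet_le (by fun_prop) (by fun_prop)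

lemma sphereUniform_real_mem {n : ℕ} (hn : 0 < n) {K : Set (EuclideanSpace ℝ (Fin n))}
    (hK : MeasurableSet K) :
    (sphereUniform n).real {x | (x : EuclideanSpace ℝ (Fin n)) ∈ K} =
      (stdGaussian (EuclideanSpace ℝ (Fin n))).real {y | ‖y‖⁻¹ • y ∈ K} := by
  have : Nonempty (Fin n) := ⟨⟨0, hn⟩⟩
  rw [Measure.real, Measure.real, stdGaussian_normalize_mem hK, sphereUniform,
    Measure.smul_apply, smul_eq_mul]

/-- Completing the square gives `-x ^ 2 ≤ 1 / 16 - x / 2` at `x = log n`. -/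
lemma exp_neg_log_sq_le {n : ℕ} (hn : 0 < n) : rexp (-(log n) ^ 2) ≤ 2 / √n := by
  have hn' : (0 : ℝ) < n := by exact_mod_cast hn
  have h1 : rexp (-(log n / 2)) = 1 / √n := by
    rw [Real.exp_neg, ← Real.log_sqrt hn'.le, Real.exp_log (Real.sqrt_pos.2 hn'), one_div]
  have h2 : rexp (1 / 16) ≤ 2 := by
    have h3 : rexp (1 / 16) ≤ rexp (log 2) :=
      Real.exp_le_exp.2 (by linarith [Real.log_two_gt_d9])
    rwa [Real.exp_log (by norm_num)] at h3
  calc rexp (-(log n) ^ 2) ≤ rexp (1 / 16 + -(log n / 2)) :=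
        Real.exp_le_exp.2 (by nlinarith [sq_nonneg (log n - 1 / 4)])
    _ = rexp (1 / 16) * (1 / √n) := by rw [Real.exp_add, h1]
    _ ≤ 2 * (1 / √n) := by gcongr
    _ = 2 / √n := by ring

theorem lemma6p3 :
    ∃ C : ℝ, 0 < C ∧ ∀ (n k : ℕ), 2 ≤ n → 2 ≤ k →
      ∀ (W : Matrix (Fin n) (Fin k) ℝ) (θ : Fin k → ℝ),
        |(sphereUniform n).real {x | (x : EuclideanSpace ℝ (Fin n)) ∈ polytope W θ} -
            (ProbabilityTheory.stdGaussian (EuclideanSpace ℝ (Fin n))).real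
              {y | (Real.sqrt n)⁻¹ • y ∈ polytope W θ}| ≤
          C * Real.log n * Real.log k / Real.sqrt n := by
  refine ⟨3000, by norm_num, fun n k hn hk W θ ↦ ?_⟩
  have hn0 : 0 < n := by omega
  have hs : 0 < √(n : ℝ) := Real.sqrt_pos.2 (by exact_mod_cast hn0)
  have hlog : ∀ m : ℕ, 2 ≤ m → 1 / 2 ≤ log m := fun m hm ↦ by
    have : log 2 ≤ log m := log_le_log (by norm_num) (by exact_mod_cast hm)
    linarith [Real.log_two_gt_d9]
  have hLn := hlog n hn
  have hLk := hlog k hk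
  have : Nonempty (Fin n) := ⟨⟨0, hn0⟩⟩
  rw [sphereUniform_real_mem hn0 (measurableSet_polytope W θ)]
  -- Turns the tail exponent `n * ε ^ 2 / 16` into `(log n) ^ 2`.
  set ε := 4 * log n / √n with hε
  have hε0 : 0 < ε := by positivity
  rcases le_total ε (1 / 4) with hsmall | hbig
  · have hmain := abs_stdGaussian_normalize_sub_scaled_le
      (E := EuclideanSpace ℝ (Fin n)) hk (fun j ↦ WithLp.toLp 2 (W.transpose j)) θ hε0 hsmall
    rw [finrank_euclideanSpace_fin] at hmain
    have hset : {y : EuclideanSpace ℝ (Fin n) | (√n)⁻¹ • y ∈ polytope W θ} =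
        {y | ∀ j, ⟪WithLp.toLp 2 (W.transpose j), y⟫ ≤ √n * θ j} := by
      ext y
      simp only [mem_polytope_iff_inner, Set.mem_ofPred_eq, real_inner_smul_right,
        inv_mul_le_iff₀ hs]
    have hset' : {y : EuclideanSpace ℝ (Fin n) | ‖y‖⁻¹ • y ∈ polytope W θ} =
        {y | ∀ j, ⟪WithLp.toLp 2 (W.transpose j), ‖y‖⁻¹ • y⟫ ≤ θ j} := by
      ext y
      simp only [mem_polytope_iff_inner, Set.mem_ofPred_eq]
    rw [hset, hset']
    refine hmain.trans ?_
    have hexp : -((n : ℝ) * ε ^ 2 / 16) = -(log n) ^ 2 := by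
      rw [hε, div_pow, Real.sq_sqrt (Nat.cast_nonneg n)]
      field_simp
      ring
    rw [hexp]
    have h1 := exp_neg_log_sq_le hn0
    have h2 : 1 / 4 ≤ log n * log k := by nlinarith
    calc 720 * ε * log k + 2 * rexp (-(log n) ^ 2)
        ≤ 720 * ε * log k + 2 * (2 / √n) := by gcongr
      _ = (2880 * (log n * log k) + 4) / √n := by rw [hε]; ring
      _ ≤ 3000 * log n * log k / √n := by gcongr; linarith
  -- When `ε ≥ 1 / 4` the claimed bound exceeds `1`, so nothing is left to prove about the measures.
  · have h1 : |(stdGaussian (EuclideanSpace ℝ (Fin n))).real {y | ‖y‖⁻¹ • y ∈ polytope W θ} -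
        (stdGaussian (EuclideanSpace ℝ (Fin n))).real {y | (√n)⁻¹ • y ∈ polytope W θ}| ≤ 1 :=
      abs_sub_le_of_nonneg_of_le measureReal_nonneg measureReal_le_one measureReal_nonneg
        measureReal_le_one
    refine h1.trans ?_
    calc (1 : ℝ) ≤ 750 * (1 / 4) * (1 / 2) := by norm_num
      _ ≤ 750 * ε * log k := by gcongr
      _ = 3000 * log n * log k / √n := by rw [hε]; ring
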